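/- Let $k$ be an algebraically closed field and let $C$ be an irreducible smooth projective curve over $k$ with field of rational functions $k(C)$. For a closed point $x\in C$ let $\nu_x\colon k(C)\to\mathbb{Z}\cup\{\infty\}$ be the discrete valuation given by the order of vanishing at $x$, with $\nu_x(0)=\infty$. A subring $R\subseteq k(C)$ (with $1\in R$) is called a $1$-place ring if it contains a nonconstant function and there is a finite nonempty set $P$ of closed points of $C$ such that 1. $\nu_x(f)\ge 0$ for all $f\in R$ and all closed points $x\in C\setminus P$; and 2. if $\nu_x(f)<0$ for some $f\in R$ and some $x\in P$, then $\nu_y(f)<0$ for all $y\in P$. **Proposition.** If $R\subseteq k(C)$ is a $1$-place ring, then the group $\mathrm{SL}_2(R)$ is not finitely generated. -/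

import Mathlib

open CategoryTheory AlgebraicGeometry

universe u

namespace PlaceRing

noncomputable section

attribute [local instance] MvPolynomial.gradedAlgebra

/-- Projective space `ℙⁿ` over a field `k`, as `Proj k[X₀, …, Xₙ]`. -/
abbrev ProjSpace (k : Type u) [Field k] (n : ℕ) : Scheme.{u} :=
  Proj (MvPolynomial.homogeneousSubmodule (Fin (n + 1)) k)

/-- The structure morphism `ℙⁿ ⟶ Spec k`. -/
def projSpaceToSpec (k : Type u) [Field k] (n : ℕ) :
    ProjSpace k n ⟶ Spec (CommRingCat.of k) :=
  Proj.toSpecZero (MvPolynomial.homogeneousSubmodule (Fin (n + 1)) k) ≫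
    Spec.map (CommRingCat.ofHom
      (algebraMap k (MvPolynomial.homogeneousSubmodule (Fin (n + 1)) k 0)))

variable {k : Type u} [Field k] {C : Scheme.{u}}

/-- A `k`-scheme is projective if it is a closed subscheme of some projective space over `k`. -/
def IsProjective (π : C ⟶ Spec (CommRingCat.of k)) : Prop :=
  ∃ (n : ℕ) (i : C ⟶ ProjSpace k n), IsClosedImmersion i ∧ i ≫ projSpaceToSpec k n = π

theorem isLocallyNoetherian_of_smooth (π : C ⟶ Spec (CommRingCat.of k))
    [SmoothOfRelativeDimension 1 π] : IsLocallyNoetherian C :=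
  have : Smooth π := SmoothOfRelativeDimension.smooth 1 π
  LocallyOfFiniteType.isLocallyNoetherian π

section

variable [IsIntegral C] (π : C ⟶ Spec (CommRingCat.of k))

/-- The inclusion of the base field into the field of rational functions, as the constant
functions. -/
def constants : k →+* C.functionField :=
  haveI : Nonempty (⊤ : C.Opens) := ⟨⟨genericPoint C, trivial⟩⟩
  ((Scheme.ΓSpecIso (CommRingCat.of k)).inv ≫ π.appTop ≫ C.germToFunctionField ⊤).hom

open scoped Classical in
/-- The discrete valuation at a point `x` of a smooth curve: the order of vanishing at `x`,
extended by `∞` at the zero function. It is only used at closed points, which are exactly the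
points of codimension one. -/
def valuationAt [SmoothOfRelativeDimension 1 π] (x : C) (f : C.functionField) : WithTop ℤ :=
  haveI : IsLocallyNoetherian C := isLocallyNoetherian_of_smooth π
  if f = 0 then ⊤ else ((Scheme.ord f x : ℤ) : WithTop ℤ)

/-- A subring `R` of the field of rational functions of a smooth curve is an `n`-place ring if it
contains a nonconstant function and there are pairwise disjoint, finite, nonempty sets
`P 0, …, P (n - 1)` of closed points such that
* the functions in `R` have no poles outside the union of the `P i`, and
* a function in `R` with a pole at some point of `P i` has a pole at every point of `P i`. -/
structure IsPlaceRing [SmoothOfRelativeDimension 1 π] (n : ℕ) (R : Subring C.functionField) :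
    Prop where
  exists_nonconstant : ∃ f ∈ R, f ∉ Set.range (constants π)
  exists_places : ∃ P : Fin n → Set C,
    (∀ i, (P i).Finite) ∧ (∀ i, (P i).Nonempty) ∧ (∀ i, P i ⊆ closedPoints C) ∧
    Pairwise (fun i j => Disjoint (P i) (P j)) ∧
    (∀ f ∈ R, ∀ x ∈ closedPoints C, x ∉ ⋃ i, P i → 0 ≤ valuationAt π x f) ∧
    (∀ i, ∀ x ∈ P i, ∀ f ∈ R, valuationAt π x f < 0 → ∀ y ∈ P i, valuationAt π y f < 0)

end

end

end PlaceRing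

/-! ### Row domination in `SL₂` of a valued field -/

section SpecialLinear

variable {K Γ₀ : Type*} [Field K] [LinearOrderedCommGroupWithZero Γ₀] (v : Valuation K Γ₀)

/-! Fix `x` in the pole set. An element of `R` without a pole at `x` has no poles at all, hence is
constant since `C` is proper. So the multiplicative valuation at `x` is at least 1 on nonzero
elements of `R` and exceeds 1 at a nonconstant one.

For a finite set `S` of matrices, choose `g` in `R` with valuation above 1 and above those of all
entries of `S`. The condition "top row smaller than `v g` times the bottom row" holds for the
identity and survives right multiplication by elements of `S` and their inverses, but fails for the
elementary matrix with corner `g`. So `S` does not generate.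

The geometric input is that closed points have DVRs as local rings and that functions regular at all
closed points are constant. -/

/-- If `a` is dominated by `h * c` in a matrix with rows `(a, b)` and `(c, d)` and determinant of
valuation one, then multiplication by a column with small second entry preserves the domination of
the first row by `h` times the second. -/
theorem Valuation.map_row_lt {a b c d p r : K} {h L C : Γ₀}
    (hdet : v (a * d - b * c) = 1) (hc : 1 ≤ v c) (ha : v a < h * v c) (hr : v r ≤ L)
    (hL : L < h) (hC : 1 ≤ C) (hx : v (c * p + d * r) ≤ C) : v (a * p + b * r) < h * C := by
  have hc0 : c ≠ 0 := by
    rintro rfl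
    simp at hc
  have hvc : 0 < v c := lt_of_lt_of_le zero_lt_one hc
  -- Solving for `b` through the determinant leaves `a / c` times the new bottom entry, plus an
  -- error of size at most `v r`.
  have key : a * p + b * r = (a / c) * (c * p + d * r) - (a * d - b * c) * r / c := by
    field_simp
    ring
  rw [key]
  refine lt_of_le_of_lt (v.map_sub _ _) (max_lt ?_ ?_)
  · rw [map_mul, map_div₀]
    exact (mul_le_mul_right hx _).trans_lt
      (mul_lt_mul_of_pos_right ((div_lt_iff₀ hvc).2 ha) (lt_of_lt_of_le zero_lt_one hC))
  · rw [map_div₀, map_mul, hdet, one_mul]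
    calc v r / v c ≤ v r := div_le_of_le_mul₀ zero_le zero_le (le_mul_of_one_le_right zero_le hc)
      _ ≤ L := hr
      _ < h := hL
      _ ≤ h * C := le_mul_of_one_le_right zero_le hC

/-- If the first row of a matrix of determinant of valuation one is dominated by `h` times its
second row, then this persists after right multiplication by a matrix with entries of valuation
less than `h`. -/
theorem Valuation.max_row_mul_lt {a b c d p q r t : K} {h L : Γ₀}
    (hdet : v (a * d - b * c) = 1) (hcd : 1 ≤ max (v c) (v d))
    (hlt : max (v a) (v b) < h * max (v c) (v d))
    (hp : v p ≤ L) (hq : v q ≤ L) (hr : v r ≤ L) (ht : v t ≤ L) (hL : L < h)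
    (hC : 1 ≤ max (v (c * p + d * r)) (v (c * q + d * t))) :
    max (v (a * p + b * r)) (v (a * q + b * t)) <
      h * max (v (c * p + d * r)) (v (c * q + d * t)) := by
  rcases le_total (v d) (v c) with hdc | hdc
  · rw [max_eq_left hdc] at hcd hlt
    have ha := (le_max_left _ _).trans_lt hlt
    exact max_lt (v.map_row_lt hdet hcd ha hr hL hC (le_max_left _ _))
      (v.map_row_lt hdet hcd ha ht hL hC (le_max_right _ _))
  · rw [max_eq_right hdc] at hcd hlt
    have hb := (le_max_right _ _).trans_lt hlt
    rw [← Valuation.map_neg, neg_sub] at hdet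
    rw [add_comm (a * p), add_comm (a * q)]
    exact max_lt
      (v.map_row_lt hdet hcd hb hp hL hC (by rw [add_comm]; exact le_max_left _ _))
      (v.map_row_lt hdet hcd hb hq hL hC (by rw [add_comm]; exact le_max_right _ _))

variable {v}

/-- If every nonzero element of a subring `R` of a field has valuation at least one, and some
element has valuation greater than one, then `SL₂(R)` is not finitely generated. -/
theorem Matrix.SpecialLinearGroup.not_fg_of_one_le_valuation [MulArchimedean Γ₀] (R : Subring K)
    (hR : ∀ r ∈ R, r ≠ 0 → 1 ≤ v r) {f : K} (hfR : f ∈ R) (hf : 1 < v f) :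
    ¬ Group.FG (Matrix.SpecialLinearGroup (Fin 2) R) := by
  rintro ⟨S, hS⟩
  obtain ⟨M, hM⟩ := (S.image fun s : Matrix.SpecialLinearGroup (Fin 2) R =>
    max (max (v (s 0 0)) (v (s 0 1))) (max (v (s 1 0)) (v (s 1 1)))).exists_le
  simp only [Finset.mem_image, forall_exists_index, and_imp, forall_apply_eq_imp_iff₂,
    max_le_iff] at hM
  obtain ⟨n, hn⟩ : ∃ n, max M 1 < v f ^ n := by
    obtain ⟨m, hm⟩ := MulArchimedean.arch (max M 1) hf
    -- The archimedean property gives only `≤`; one more power makes it strict.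
    exact ⟨m + 1, hm.trans_lt (pow_lt_pow_right₀ hf m.lt_succ_self)⟩
  rw [← map_pow] at hn
  set g := f ^ n
  have hgR : g ∈ R := pow_mem hfR n
  -- A bottom row cannot vanish, and nonzero elements of `R` have valuation at least 1.
  have hrow : ∀ x : Matrix.SpecialLinearGroup (Fin 2) R, 1 ≤ max (v (x 1 0)) (v (x 1 1)) := by
    intro x
    by_cases h0 : x 1 0 = 0
    · refine le_max_of_le_right (hR _ (x 1 1).2 fun h1 => ?_)
      have := x.det_coe
      rw [Matrix.det_fin_two] at this
      simp_all
    · exact le_max_of_le_left (hR _ (x 1 0).2 (by simpa using h0))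
  have hdet : ∀ x : Matrix.SpecialLinearGroup (Fin 2) R,
      v ((x 0 0 : K) * x 1 1 - x 0 1 * x 1 0) = 1 := by
    intro x
    have := congrArg (fun r : R => (r : K)) x.det_coe
    rw [Matrix.det_fin_two] at this
    push_cast at this
    rw [this, map_one]
  have hmul : ∀ x s : Matrix.SpecialLinearGroup (Fin 2) R,
      v (s 0 0) ≤ M → v (s 0 1) ≤ M → v (s 1 0) ≤ M → v (s 1 1) ≤ M →
      max (v (x 0 0)) (v (x 0 1)) < v g * max (v (x 1 0)) (v (x 1 1)) →
      max (v ((x * s) 0 0)) (v ((x * s) 0 1)) <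
        v g * max (v ((x * s) 1 0)) (v ((x * s) 1 1)) := by
    intro x s h00 h01 h10 h11 hx
    have hC := hrow (x * s)
    simp only [Matrix.SpecialLinearGroup.coe_mul, Matrix.mul_apply, Fin.sum_univ_two,
      Subring.coe_add, Subring.coe_mul] at hC ⊢
    exact v.max_row_mul_lt (hdet x) (hrow x) hx h00 h01 h10 h11 ((le_max_left _ _).trans_lt hn) hC
  have hall : ∀ x : Matrix.SpecialLinearGroup (Fin 2) R,
      max (v (x 0 0)) (v (x 0 1)) < v g * max (v (x 1 0)) (v (x 1 1)) := by
    intro x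
    have hx : x ∈ Subgroup.closure (S : Set (Matrix.SpecialLinearGroup (Fin 2) R)) :=
      hS ▸ Subgroup.mem_top x
    induction hx using Subgroup.closure_induction_right with
    | one => simpa using (le_max_right M 1).trans_lt hn
    | mul_right x hx s hs ih =>
      obtain ⟨⟨h00, h01⟩, h10, h11⟩ := hM s hs
      exact hmul x s h00 h01 h10 h11 ih
    | mul_inv_cancel x hx s hs ih =>
      obtain ⟨⟨h00, h01⟩, h10, h11⟩ := hM s hs
      -- The inverse is the adjugate: the same entries up to place and sign.
      refine hmul x s⁻¹ ?_ ?_ ?_ ?_ ih <;> simpa [Matrix.adjugate_fin_two]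
  have := hall ⟨!![1, ⟨g, hgR⟩; 0, 1], by simp [Matrix.det_fin_two]⟩
  simp at this

end SpecialLinear

/-! ### Smoothness of dimension one gives DVRs -/

section SmoothCurve

open TensorProduct

/-- A Noetherian local domain over a field `k` with residue field `k`, whose Kähler differentials
have rank one at the closed point, is a discrete valuation ring. -/
theorem IsLocalRing.isDiscreteValuationRing_of_finrank_kaehlerDifferential {k A : Type*} [Field k]
    [CommRing A] [IsDomain A] [IsLocalRing A] [IsNoetherianRing A] [Algebra k A]
    (hk : Function.Surjective (algebraMap k (IsLocalRing.ResidueField A)))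
    (hΩ : Module.finrank (IsLocalRing.ResidueField A)
      (IsLocalRing.ResidueField A ⊗[A] Ω[A⁄k]) = 1) :
    IsDiscreteValuationRing A := by
  have hA : Function.Surjective (algebraMap A (IsLocalRing.ResidueField A)) :=
    IsLocalRing.residue_surjective
  let e : k ≃ₐ[k] IsLocalRing.ResidueField A :=
    AlgEquiv.ofBijective (Algebra.ofId k _) ⟨(algebraMap k _).injective, hk⟩
  -- The copy of the residue field inside `A` splits the conormal sequence, making `m/m² → κ ⊗ Ω`
  -- injective; it is onto because `Ω[κ⁄k] = 0`.
  have hsec : (IsScalarTower.toAlgHom k A (IsLocalRing.ResidueField A)).kerSquareLift.comp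
      ((Algebra.ofId k _).comp e.symm.toAlgHom) = AlgHom.id k _ := by
    ext x
    obtain ⟨y, rfl⟩ := e.surjective x
    change (IsScalarTower.toAlgHom k A _).kerSquareLift (algebraMap k _ (e.symm (e y))) = e y
    rw [e.symm_apply_apply, AlgHom.commutes]
    rfl
  let l := (retractionKerCotangentToTensorEquivSection hA).symm ⟨_, hsec⟩
  have hinj : Function.Injective
      (KaehlerDifferential.kerCotangentToTensor k A (IsLocalRing.ResidueField A)) :=
    Function.LeftInverse.injective (g := l.1) fun x => LinearMap.congr_fun l.2 x
  have hsurj : Function.Surjective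
      (KaehlerDifferential.kerCotangentToTensor k A (IsLocalRing.ResidueField A)) := by
    have := KaehlerDifferential.subsingleton_of_surjective k _ hk
    intro y
    exact (KaehlerDifferential.exact_kerCotangentToTensor_mapBaseChange k A _ hA y).1
      (Subsingleton.elim _ _)
  obtain ⟨e'⟩ : Nonempty (CotangentSpace A ≃ₗ[A]
      (RingHom.ker (algebraMap A (IsLocalRing.ResidueField A))).Cotangent) := by
    rw [show RingHom.ker (algebraMap A (IsLocalRing.ResidueField A)) = maximalIdeal A from
      IsLocalRing.ker_residue]
    exact ⟨.refl _ _⟩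
  rw [← IsLocalRing.finrank_CotangentSpace_eq_one_iff, ← hΩ]
  exact ((e'.trans (LinearEquiv.ofBijective _ ⟨hinj, hsurj⟩)).extendScalarsOfSurjective
    hA).finrank_eq

/-- The local ring of a smooth algebra of relative dimension one at a rational point is a discrete
valuation ring if it is a domain. -/
theorem IsLocalization.AtPrime.isDiscreteValuationRing_of_isStandardSmooth {k A : Type*} [Field k]
    [CommRing A] [IsNoetherianRing A] [Algebra k A]
    [Algebra.IsStandardSmoothOfRelativeDimension 1 k A]
    (p : Ideal A) [p.IsPrime] (B : Type*) [CommRing B] [IsDomain B] [IsLocalRing B] [Algebra A B]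
    [Algebra k B] [IsScalarTower k A B] [IsLocalization.AtPrime B p]
    (hk : Function.Surjective (algebraMap k (IsLocalRing.ResidueField B))) :
    IsDiscreteValuationRing B := by
  have : IsNoetherianRing B := IsLocalization.isNoetherianRing p.primeCompl B inferInstance
  have : Algebra.FormallyEtale A B := .of_isLocalization p.primeCompl
  have : Nontrivial A := (algebraMap A B).domain_nontrivial
  have : Algebra.IsStandardSmooth k A :=
    Algebra.IsStandardSmoothOfRelativeDimension.isStandardSmooth 1
  refine IsLocalRing.isDiscreteValuationRing_of_finrank_kaehlerDifferential hk ?_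
  have e := KaehlerDifferential.tensorKaehlerEquivOfFormallyEtale k A B
  have hfin : Module.finrank A Ω[A⁄k] = 1 := by
    simp [Module.finrank,
      Algebra.IsStandardSmoothOfRelativeDimension.rank_kaehlerDifferential (R := k) (S := A) 1]
  have : Module.Free B Ω[B⁄k] := .of_equiv e
  rw [Module.finrank_baseChange, ← e.finrank_eq, Module.finrank_baseChange, hfin]

end SmoothCurve

/-! ### Rational functions and closed points -/

namespace AlgebraicGeometry

section

variable {k : Type u} [Field k] {C : Scheme.{u}} (π : C ⟶ Spec (CommRingCat.of k))

/-- A rational function that is regular at every closed point is a global section. -/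
theorem Scheme.mem_range_germToFunctionField_top [IsIntegral C] [JacobsonSpace C]
    [Nonempty (⊤ : C.Opens)] (f : C.functionField)
    (hf : ∀ x ∈ closedPoints C, f ∈ Set.range (algebraMap (C.presheaf.stalk x) C.functionField)) :
    f ∈ Set.range (C.germToFunctionField ⊤) := by
  let ι := {V : C.Opens // ∃ _ : Nonempty V, ∃ s : Γ(C, V), C.germToFunctionField V s = f}
  have hne : ∀ i : ι, Nonempty i.1 := fun i => i.2.1
  choose s hs using fun i : ι => i.2.2
  -- In a Jacobson space, a nonempty closed complement would contain a closed point, where `f` is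
  -- regular.
  have hcover : (⊤ : C.Opens) ≤ ⨆ i : ι, i.1 := by
    by_contra hW
    obtain ⟨x, hxW, hx⟩ := nonempty_inter_closedPoints
      (Z := ((⨆ i : ι, i.1 : C.Opens) : Set C)ᶜ)
      (by
        rw [Set.nonempty_compl]
        intro h
        exact hW fun y _ => (h ▸ Set.mem_univ y : y ∈ ((⨆ i : ι, i.1 : C.Opens) : Set C)))
      (⨆ i : ι, i.1 : C.Opens).isOpen.isClosed_compl.isLocallyClosed
    obtain ⟨g, hg⟩ := hf x hx
    obtain ⟨V, hxV, t, rfl⟩ := C.presheaf.exists_germ_eq g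
    have : Nonempty V := ⟨⟨x, hxV⟩⟩
    rw [Scheme.algebraMap_germ_eq_germToFunctionField] at hg
    exact hxW (TopologicalSpace.Opens.mem_iSup.2 ⟨(⟨V, this, t, hg⟩ : ι), hxV⟩)
  have hgen : ∀ i : ι, genericPoint C ∈ i.1 := fun i =>
    ((genericPoint_spec C).mem_open_set_iff i.1.isOpen).2 (by simpa using hne i)
  obtain ⟨g, hg, -⟩ := C.sheaf.existsUnique_gluing' (fun i : ι => i.1) ⊤
    (fun i => homOfLE le_top) hcover s (by
      intro i j
      have : Nonempty (i.1 ⊓ j.1 : C.Opens) := ⟨⟨genericPoint C, hgen i, hgen j⟩⟩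
      apply C.germToFunctionField_injective (i.1 ⊓ j.1)
      refine ((C.presheaf.germ_res_apply _ _ _ _).trans ?_).trans
        (C.presheaf.germ_res_apply _ _ _ _).symm
      exact (hs i).trans (hs j).symm)
  obtain ⟨i⟩ : Nonempty ι := by
    by_contra h
    rw [not_nonempty_iff] at h
    exact (hcover (x := genericPoint C) trivial).elim (by simp)
  refine ⟨g, ?_⟩
  rw [← hs i, ← hg i]
  exact (C.presheaf.germ_res_apply _ _ _ _).symm

/-- Over an algebraically closed field, every value in the residue field of a closed point is
taken by a constant. -/
theorem residue_germ_surjective_of_isClosed [IsAlgClosed k] [LocallyOfFiniteType π] (x : C)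
    (hx : IsClosed {x}) :
    Function.Surjective ((Scheme.ΓSpecIso (CommRingCat.of k)).inv ≫ π.appTop ≫
      C.presheaf.germ ⊤ x (TopologicalSpace.Opens.mem_top x) ≫ C.residue x).hom := by
  have key : (Scheme.ΓSpecIso (CommRingCat.of k)).inv ≫ π.appTop ≫
      C.presheaf.germ ⊤ x (TopologicalSpace.Opens.mem_top x) ≫ C.residue x =
        (residueFieldIsoBase π x hx).inv := by
    rw [← cancel_mono (Scheme.ΓSpecIso (C.residueField x)).inv,
      Scheme.ΓSpecIso_inv_naturality (residueFieldIsoBase π x hx).inv,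
      SpecMap_residueFieldIsoBase_inv, Scheme.fromSpecResidueField]
    simp only [Scheme.Hom.comp_appTop, Scheme.fromSpecStalk_appTop, Category.assoc]
    rw [Scheme.ΓSpecIso_inv_naturality (C.residue x)]
    simp
  rw [key]
  exact (ConcreteCategory.bijective_of_isIso (residueFieldIsoBase π x hx).inv).2

/-- The local ring at a closed point of a smooth curve is a discrete valuation ring. -/
theorem isDiscreteValuationRing_stalk [IsAlgClosed k] [IsIntegral C]
    [SmoothOfRelativeDimension 1 π] (x : C) (hx : IsClosed {x}) :
    IsDiscreteValuationRing (C.presheaf.stalk x) := by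
  have : Smooth π := SmoothOfRelativeDimension.smooth 1 π
  have : IsLocallyNoetherian C := LocallyOfFiniteType.isLocallyNoetherian π
  obtain ⟨U, -, V, hV, hxV, e, h⟩ :=
    SmoothOfRelativeDimension.exists_isStandardSmoothOfRelativeDimension (n := 1) (f := π) x
  -- `Spec k` has a single point.
  obtain rfl : U = ⊤ := by
    ext y
    have : y = π x := Subsingleton.elim _ _
    simpa [this] using e hxV
  have hφ := (RingHom.isStandardSmoothOfRelativeDimension_respectsIso (n := 1)).2
    _ (Scheme.ΓSpecIso (CommRingCat.of k)).symm.commRingCatIsoToRingEquiv h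
  let φ : k →+* Γ(C, V) := ((Scheme.ΓSpecIso (CommRingCat.of k)).inv ≫ π.appLE ⊤ V e).hom
  let := φ.toAlgebra
  let : Algebra Γ(C, V) (C.presheaf.stalk x) := (C.presheaf.germ V x hxV).hom.toAlgebra
  let : Algebra k (C.presheaf.stalk x) := ((C.presheaf.germ V x hxV).hom.comp φ).toAlgebra
  have : IsScalarTower k Γ(C, V) (C.presheaf.stalk x) := .of_algebraMap_eq fun _ => rfl
  have : IsLocalization.AtPrime (C.presheaf.stalk x) (hV.primeIdealOf ⟨x, hxV⟩).asIdeal :=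
    hV.isLocalization_stalk ⟨x, hxV⟩
  have : IsNoetherianRing Γ(C, V) := IsLocallyNoetherian.component_noetherian ⟨V, hV⟩
  have : Algebra.IsStandardSmoothOfRelativeDimension 1 k Γ(C, V) := hφ
  refine IsLocalization.AtPrime.isDiscreteValuationRing_of_isStandardSmooth (k := k)
    (hV.primeIdealOf ⟨x, hxV⟩).asIdeal (C.presheaf.stalk x) ?_
  have hsurj := residue_germ_surjective_of_isClosed π x hx
  have hcomp : (Scheme.ΓSpecIso (CommRingCat.of k)).inv ≫ π.appTop ≫
      C.presheaf.germ ⊤ x (TopologicalSpace.Opens.mem_top x) ≫ C.residue x =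
      (Scheme.ΓSpecIso (CommRingCat.of k)).inv ≫ π.appLE ⊤ V e ≫
        C.presheaf.germ V x hxV ≫ C.residue x := by
    rw [Scheme.Hom.appLE, Category.assoc, C.presheaf.germ_res_assoc]
    rfl
  rw [hcomp] at hsurj
  exact hsurj

/-- Needed to identify `Scheme.ord` with the order in the local ring. -/
theorem coheight_eq_one_of_isClosed [IsAlgClosed k] [IsIntegral C]
    [SmoothOfRelativeDimension 1 π] (x : C) (hx : IsClosed {x}) : Order.coheight x = 1 := by
  have := isDiscreteValuationRing_stalk π x hx
  have h := IsDiscreteValuationRing.ringKrullDim_eq_one (C.presheaf.stalk x)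
  rw [ringKrullDim_stalk_eq_coheight] at h
  exact_mod_cast h

end

end AlgebraicGeometry

/-! ### Constants and valuations on the curve -/

namespace PlaceRing

variable {k : Type u} [Field k] {C : Scheme.{u}} (π : C ⟶ Spec (CommRingCat.of k))

-- `Proj` is proper over `Spec` of the degree-zero part, which consists of the constants `k`.
attribute [local instance] MvPolynomial.gradedAlgebra in
theorem IsProjective.isProper (hπ : IsProjective π) : IsProper π := by
  obtain ⟨n, i, hi, rfl⟩ := hπ
  let A := MvPolynomial.homogeneousSubmodule (Fin (n + 1)) k
  have : IsScalarTower k (A 0) (MvPolynomial (Fin (n + 1)) k) :=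
    IsScalarTower.of_algebraMap_eq (R := k) (S := A 0) (A := MvPolynomial (Fin (n + 1)) k)
      fun _ => rfl
  have : Algebra.FiniteType (A 0) (MvPolynomial (Fin (n + 1)) k) :=
    .of_restrictScalars_finiteType k _ _
  have hsurj : Function.Surjective (algebraMap k (A 0)) := by
    rintro ⟨p, hp⟩
    refine ⟨p.coeff 0, Subtype.ext ?_⟩
    exact (MvPolynomial.totalDegree_eq_zero_iff_eq_C.1
      ((MvPolynomial.totalDegree_zero_iff_isHomogeneous _).2 hp)).symm
  have : IsClosedImmersion (Spec.map (CommRingCat.ofHom (algebraMap k (A 0)))) :=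
    IsClosedImmersion.spec_of_surjective _ hsurj
  have : IsProper (projSpaceToSpec k n) := by
    unfold projSpaceToSpec
    infer_instance
  infer_instance

variable [IsIntegral C]

/-- The only global functions on a proper integral scheme over an algebraically closed field are
the constants. -/
theorem mem_range_constants [IsAlgClosed k] [IsProper π] [Nonempty (⊤ : C.Opens)]
    (f : C.functionField)
    (hf : f ∈ Set.range (C.germToFunctionField ⊤)) : f ∈ Set.range (constants π) := by
  obtain ⟨g, rfl⟩ := hf
  let φ : k →+* Γ(C, ⊤) := ((Scheme.ΓSpecIso (CommRingCat.of k)).inv ≫ π.appTop).hom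
  have hφ : φ.IsIntegral := by
    apply RingHom.isIntegral_respectsIso.2
      (e := (Scheme.ΓSpecIso _).symm.commRingCatIsoToRingEquiv)
    exact isIntegral_appTop_of_universallyClosed π
  obtain ⟨a, rfl⟩ := (IsAlgClosed.ringHom_bijective_of_isIntegral φ hφ).2 g
  exact ⟨a, rfl⟩

theorem constants_mem_range_algebraMap_stalk (x : C) (a : k) :
    constants π a ∈ Set.range (algebraMap (C.presheaf.stalk x) C.functionField) :=
  haveI : Nonempty (⊤ : C.Opens) := ⟨⟨genericPoint C, trivial⟩⟩
  ⟨_, Scheme.algebraMap_germ_eq_germToFunctionField C (TopologicalSpace.Opens.mem_top x) _⟩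

section

variable [IsAlgClosed k] [SmoothOfRelativeDimension 1 π]

/-- The order of vanishing at a closed point of a smooth curve comes from a valuation whose
valuation ring is the local ring at that point. -/
theorem exists_valuation (x : C) (hx : IsClosed {x}) :
    ∃ v : Valuation C.functionField (WithZero (Multiplicative ℤ)),
      (∀ f, v f ≤ 1 ↔ 0 ≤ valuationAt π x f) ∧
      (∀ f, v f ≤ 1 ↔ f ∈ Set.range (algebraMap (C.presheaf.stalk x) C.functionField)) := by
  have := isDiscreteValuationRing_stalk π x hx
  have : IsLocallyNoetherian C := isLocallyNoetherian_of_smooth π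
  have hx1 := coheight_eq_one_of_isClosed π x hx
  let v := (IsDiscreteValuationRing.maximalIdeal (C.presheaf.stalk x)).valuation C.functionField
  -- The sign flips: poles have multiplicative valuation above 1.
  have hv : ∀ f, f ≠ 0 → v f = WithZero.exp (- Scheme.ord f x) := by
    intro f hf
    have h1 := (Scheme.ord_eq_iff hx1 hf).1 rfl
    have h2 : Scheme.ordHom x hx1 f = (v f)⁻¹ := Ring.ordFrac_eq_valuation_inv f
    rw [h2] at h1
    rw [← inv_inv (v f), h1]
    rfl
  refine ⟨v, fun f => ?_, fun f => ⟨fun hf => ?_, ?_⟩⟩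
  · by_cases h : f = 0
    · simp [h, valuationAt]
    · rw [hv f h, valuationAt, if_neg h, ← WithZero.exp_zero, WithZero.exp_le_exp]
      simp
  · exact IsDiscreteValuationRing.exists_lift_of_le_one hf
  · rintro ⟨s, rfl⟩
    exact IsDedekindDomain.HeightOneSpectrum.valuation_le_one _ s

end

end PlaceRing

theorem proposition4p1 {k : Type u} [Field k] [IsAlgClosed k] {C : Scheme.{u}} [IsIntegral C]
    (π : C ⟶ Spec (CommRingCat.of k)) [SmoothOfRelativeDimension 1 π]
    (hproj : PlaceRing.IsProjective π) (R : Subring C.functionField)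
    (hR : PlaceRing.IsPlaceRing π 1 R) :
    ¬ Group.FG (Matrix.SpecialLinearGroup (Fin 2) R) := by
  have : Nonempty (⊤ : C.Opens) := ⟨⟨genericPoint C, trivial⟩⟩
  have : IsProper π := hproj.isProper
  have : JacobsonSpace C := LocallyOfFiniteType.jacobsonSpace π
  obtain ⟨⟨f, hfR, hf⟩, P, -, hne, hcl, -, hpole, hsame⟩ := hR
  obtain ⟨x, hx⟩ := hne 0
  have hunion : ∀ y, y ∉ P 0 → y ∉ ⋃ i, P i := by simp
  have hconst : ∀ g ∈ R, 0 ≤ PlaceRing.valuationAt π x g →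
      g ∈ Set.range (PlaceRing.constants π) := by
    intro g hg hgx
    refine PlaceRing.mem_range_constants π g
      (Scheme.mem_range_germToFunctionField_top g fun y hy => ?_)
    obtain ⟨v, hv, hmem⟩ := PlaceRing.exists_valuation π y hy
    refine (hmem g).1 ((hv g).2 ?_)
    by_cases hyP : y ∈ P 0
    · by_contra! h
      exact absurd (hsame 0 y hyP g hg h x hx) hgx.not_gt
    · exact hpole g hg y hy (hunion y hyP)
  obtain ⟨v, hv, hmem⟩ := PlaceRing.exists_valuation π x (hcl 0 hx)
  refine Matrix.SpecialLinearGroup.not_fg_of_one_le_valuation (v := v) R (fun r hr hr0 => ?_) hfR ?_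
  · by_contra! h
    obtain ⟨a, rfl⟩ := hconst r hr ((hv r).1 h.le)
    -- A nonzero constant of valuation below 1 would have an inverse with a pole at `x`, yet that
    -- inverse is also constant.
    have hinv := (hmem _).2 (PlaceRing.constants_mem_range_algebraMap_stalk π x a⁻¹)
    rw [map_inv₀, map_inv₀] at hinv
    exact hinv.not_gt ((one_lt_inv₀ (v.pos_iff.2 hr0)).2 h)
  · by_contra! h
    exact hf (hconst f hfR ((hv f).1 h))
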